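/- Let $(B^n,g_B)$ and $(F^m,g_F)$ be nonempty smooth Riemannian manifolds of dimensions $n,m\ge 1$, let $f>0$, $h$ and $\lambda$ be smooth functions on $B$, and let $\tilde h,\tilde\lambda$ be the lifts of $h,\lambda$ to $B\times F$. Let $g=g_B+f^2g_F$ be the warped metric on $B\times F$, with scalar curvature $R_g$, and let $\alpha,\beta,\mu,\rho$ be real constants with $\beta\neq 0$. Then the equation $$\alpha\,\mathrm{Ric}_g+\beta\nabla^2\tilde h+\mu\, d\tilde h\otimes d\tilde h=(\rho R_g+\tilde\lambda)\,g\qquad(\ast)$$ holds on $B\times F$ if and only if the following conditions hold. (a) On $B$ (that is, at every point of $B$, for the value of $R_g$ at every point of $B\times F$ above it), $$\alpha\,\mathrm{Ric}_{g_B}+\beta\nabla^2h+\mu\, dh\otimes dh=\frac{\alpha m}{f}\nabla^2 f+(\rho R_g+\lambda)\,g_B .$$ (b) The scalar curvature $R_{g_F}$ of the fiber is constant (this requirement is dropped if $\alpha=\rho=0$), and $$\Big(\frac{\alpha}{m}-\rho\Big)R_{g_F}=\rho R_{g_B}f^2+\lambda f^2+(\alpha-2m\rho)f\Delta f-\beta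 f\,\nabla h(f)+(m-1)(\alpha-m\rho)|\nabla f|^2 .$$ (c) If $\alpha\neq0$, then $(F,g_F)$ is an Einstein manifold, that is, $\mathrm{Ric}_{g_F}=\theta g_F$ for a constant $\theta$. Consequently, $g$ is a gradient Einstein-type metric with potential function $\tilde h$ and soliton function $\tilde\lambda$, i.e. a geodesically complete metric that satisfies $(\ast)$, if and only if $g$ is geodesically complete and (a), (b), (c) hold. -/

import Mathlib

open Bundle Manifold ContDiff Set

set_option maxSynthPendingDepth 3

noncomputable section

namespace WarpedEinstein

/-! ### Linear algebra of a bilinear form on a topological vector space -/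

section Linear

variable {V W : Type*} [TopologicalSpace V] [AddCommGroup V] [Module ℝ V]
  [TopologicalSpace W] [AddCommGroup W] [Module ℝ W]

/-- The pullback `(v, w) ↦ b (L v) (L w)` of a bilinear form along a linear map. -/
def pullbackForm (b : W →L[ℝ] W →L[ℝ] ℝ) (L : V →L[ℝ] W) : V →L[ℝ] V →L[ℝ] ℝ :=
  (ContinuousLinearMap.precomp ℝ L).comp (b.comp L)

@[simp] theorem pullbackForm_apply (b : W →L[ℝ] W →L[ℝ] ℝ) (L : V →L[ℝ] W) (v w : V) :
    pullbackForm b L v w = b (L v) (L w) := rfl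

/-- The vector `φ♯` dual to the covector `φ` with respect to a nondegenerate form `g`,
that is, `g (φ♯) w = φ w` for all `w`. -/
def sharp (g : V →L[ℝ] V →L[ℝ] ℝ) (φ : V →L[ℝ] ℝ) : V := g.inverse φ

/-- The trace of the bilinear form `T` with respect to the nondegenerate form `g`, that is, the
trace of the endomorphism `A` with `g (A v) w = T v w` (in coordinates `g^{ij} T_{ij}`). -/
def metricTrace (g T : V →L[ℝ] V →L[ℝ] ℝ) : ℝ :=
  LinearMap.trace ℝ V (g.inverse.comp T : V →L[ℝ] V)

end Linear

/-! ### Riemannian geometry of a field of bilinear forms on a vector space -/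

section Coordinates

variable {E : Type*} [NormedAddCommGroup E] [NormedSpace ℝ E]

/-- The Christoffel symbols of the second kind of the metric `G` at `u`:
`G(Γ(v, w), z) = ½ (∂_v G(w, z) + ∂_w G(v, z) - ∂_z G(v, w))`. -/
def christoffel (G : E → E →L[ℝ] E →L[ℝ] ℝ) (u : E) : E →L[ℝ] E →L[ℝ] E :=
  (ContinuousLinearMap.postcomp E (G u).inverse).comp ((1 / 2 : ℝ) •
    (fderiv ℝ G u + (fderiv ℝ G u).flip
      - ((ContinuousLinearMap.flipₗᵢ ℝ E E ℝ).toContinuousLinearEquiv :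
          (E →L[ℝ] E →L[ℝ] ℝ) →L[ℝ] (E →L[ℝ] E →L[ℝ] ℝ)).comp
          (fderiv ℝ G u).flip))

theorem christoffel_apply (G : E → E →L[ℝ] E →L[ℝ] ℝ) (u v w : E) :
    christoffel G u v w = (G u).inverse ((1 / 2 : ℝ) •
      (fderiv ℝ G u v w + fderiv ℝ G u w v - ((fderiv ℝ G u).flip v).flip w)) := rfl

/-- The Riemann curvature `v ↦ R(v, w)z` of the metric `G` at `u`, where
`R(v, w)z = ∂_v Γ(w, z) - ∂_w Γ(v, z) + Γ(v, Γ(w, z)) - Γ(w, Γ(v, z))`. -/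
def curvature (G : E → E →L[ℝ] E →L[ℝ] ℝ) (u w z : E) : E →L[ℝ] E :=
  ((fderiv ℝ (christoffel G) u).flip w).flip z - (fderiv ℝ (christoffel G) u w).flip z
    + (christoffel G u).flip (christoffel G u w z)
    - (christoffel G u w).comp ((christoffel G u).flip z)

theorem curvature_apply (G : E → E →L[ℝ] E →L[ℝ] ℝ) (u v w z : E) :
    curvature G u w z v = fderiv ℝ (christoffel G) u v w z - fderiv ℝ (christoffel G) u w v z
      + christoffel G u v (christoffel G u w z) - christoffel G u w (christoffel G u v z) := rfl


/-- The Ricci curvature `Ric(w, z) = tr (v ↦ R(v, w)z)` of the metric `G` at `u`. -/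
def coordRicci [FiniteDimensional ℝ E] (G : E → E →L[ℝ] E →L[ℝ] ℝ) (u : E) : E →L[ℝ] E →L[ℝ] ℝ :=
  (LinearMap.mk₂ ℝ
    (fun w z ↦ LinearMap.trace ℝ E (curvature G u w z : E →ₗ[ℝ] E))
    (fun w w' z ↦ by
      rw [← map_add]; congr 1; ext v; simp [curvature_apply]; abel)
    (fun c w z ↦ by
      rw [← map_smul]; congr 1; ext v; simp [curvature_apply, smul_sub, smul_add])
    (fun w z z' ↦ by
      rw [← map_add]; congr 1; ext v; simp [curvature_apply]; abel)
    (fun c w z ↦ by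
      rw [← map_smul]; congr 1; ext v;
      simp [curvature_apply, smul_sub, smul_add])).toContinuousBilinearMap

/-- The Hessian `∇²f(v, w) = ∂_v ∂_w f - df(Γ(v, w))` of `f` at `u` in the metric `G`. -/
def coordHessian (G : E → E →L[ℝ] E →L[ℝ] ℝ) (f : E → ℝ) (u : E) : E →L[ℝ] E →L[ℝ] ℝ :=
  fderiv ℝ (fderiv ℝ f) u - (ContinuousLinearMap.postcomp E (fderiv ℝ f u)).comp (christoffel G u)

theorem coordHessian_apply (G : E → E →L[ℝ] E →L[ℝ] ℝ) (f : E → ℝ) (u v w : E) :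
    coordHessian G f u v w = fderiv ℝ (fderiv ℝ f) u v w - fderiv ℝ f u (christoffel G u v w) := rfl

end Coordinates

/-! ### Riemannian manifolds -/

section Manifold

variable {E : Type*} [NormedAddCommGroup E] [NormedSpace ℝ E] [FiniteDimensional ℝ E]
  {H : Type*} [TopologicalSpace H] {I : ModelWithCorners ℝ E H}
  {M : Type*} [TopologicalSpace M] [ChartedSpace H M] [IsManifold I ∞ M]

/-- A smooth Riemannian metric on the manifold `M`. -/
abbrev SmoothMetric {E : Type*} [NormedAddCommGroup E] [NormedSpace ℝ E]
    {H : Type*} [TopologicalSpace H] (I : ModelWithCorners ℝ E H)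
    (M : Type*) [TopologicalSpace M] [ChartedSpace H M] [IsManifold I ∞ M] :=
  ContMDiffRiemannianMetric I ∞ E (fun x : M ↦ TangentSpace I x)

/-- The metric read in the chart at `p`: the pullback of `g` by the inverse of that chart. -/
def chartMetric (g : SmoothMetric I M) (p : M) (u : E) : E →L[ℝ] E →L[ℝ] ℝ :=
  pullbackForm (V := E) (g.inner ((extChartAt I p).symm u))
    (mfderiv 𝓘(ℝ, E) I (extChartAt I p).symm u)

/-- The Ricci tensor of `g` at `p`, computed in the chart at `p`. -/
def ricci (g : SmoothMetric I M) (p : M) : TangentSpace I p →L[ℝ] TangentSpace I p →L[ℝ] ℝ :=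
  pullbackForm (W := E) (coordRicci (chartMetric g p) (extChartAt I p p))
    (mfderiv I 𝓘(ℝ, E) (extChartAt I p) p)

/-- The scalar curvature of `g` at `p`. -/
def scalarCurvature (g : SmoothMetric I M) (p : M) : ℝ :=
  metricTrace (g.inner p) (ricci g p)

/-- The differential of the function `f` at `p`. -/
def differential (I : ModelWithCorners ℝ E H) (f : M → ℝ) (p : M) : TangentSpace I p →L[ℝ] ℝ :=
  mfderiv I 𝓘(ℝ, ℝ) f p

/-- The gradient of the function `f` at `p`. -/
def gradient (g : SmoothMetric I M) (f : M → ℝ) (p : M) : TangentSpace I p :=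
  sharp (g.inner p) (differential I f p)

/-- The Hessian of the function `f` at `p`, computed in the chart at `p`. -/
def hessian (g : SmoothMetric I M) (f : M → ℝ) (p : M) :
    TangentSpace I p →L[ℝ] TangentSpace I p →L[ℝ] ℝ :=
  pullbackForm (W := E)
    (coordHessian (chartMetric g p) (f ∘ (extChartAt I p).symm) (extChartAt I p p))
    (mfderiv I 𝓘(ℝ, E) (extChartAt I p) p)

/-- The Laplacian (the trace of the Hessian) of the function `f` at `p`. -/
def laplacian (g : SmoothMetric I M) (f : M → ℝ) (p : M) : ℝ :=
  metricTrace (g.inner p) (hessian g f p)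

/-- The metric `g` is Einstein: its Ricci tensor is a constant multiple of `g`. -/
def IsEinstein (g : SmoothMetric I M) : Prop :=
  ∃ θ : ℝ, ∀ (p : M) (v w : TangentSpace I p), ricci g p v w = θ * g.inner p v w

/-- `γ : ℝ → M` is a smooth curve that solves the geodesic equation `c'' + Γ(c', c') = 0`,
where at time `t` the curve is read in the chart at `γ t`. -/
structure IsGeodesic (g : SmoothMetric I M) (γ : ℝ → M) : Prop where
  contMDiff : ContMDiff 𝓘(ℝ, ℝ) I ∞ γ
  equation : ∀ t : ℝ,
    deriv (deriv (extChartAt I (γ t) ∘ γ)) t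
      + christoffel (chartMetric g (γ t)) (extChartAt I (γ t) (γ t))
          (deriv (extChartAt I (γ t) ∘ γ) t) (deriv (extChartAt I (γ t) ∘ γ) t) = 0

/-- Geodesic completeness: each tangent vector is the velocity at time `0` of a geodesic that is
defined on all of `ℝ`. -/
def IsGeodesicallyComplete (g : SmoothMetric I M) : Prop :=
  ∀ P : TangentBundle I M, ∃ γ : ℝ → M,
    IsGeodesic g γ ∧ tangentMap 𝓘(ℝ, ℝ) I γ ⟨0, (1 : ℝ)⟩ = P

/-- The equation `α Ric + β ∇²h + μ dh ⊗ dh = (ρ R + lam) g` on `M`. -/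
def EinsteinTypeEquation (g : SmoothMetric I M) (α β μ ρ : ℝ) (h lam : M → ℝ) : Prop :=
  ∀ (p : M) (v w : TangentSpace I p),
    α * ricci g p v w + β * hessian g h p v w + μ * (differential I h p v * differential I h p w)
      = (ρ * scalarCurvature g p + lam p) * g.inner p v w

/-- The metric `g` is a gradient Einstein-type metric with potential function `h`, soliton
function `lam` and parameters `α`, `β`, `μ`, `ρ`. -/
structure IsGradientEinsteinType (g : SmoothMetric I M) (α β μ ρ : ℝ) (h lam : M → ℝ) :
    Prop where
  complete : IsGeodesicallyComplete g
  parameters : (α, β, μ) ≠ (0, 0, 0)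
  contMDiff_potential : ContMDiff I 𝓘(ℝ, ℝ) ∞ h
  contMDiff_soliton : ContMDiff I 𝓘(ℝ, ℝ) ∞ lam
  equation : EinsteinTypeEquation g α β μ ρ h lam

end Manifold

/-! ### The warped product -/

section Warped

variable {E : Type*} [NormedAddCommGroup E] [NormedSpace ℝ E]
  {H : Type*} [TopologicalSpace H] {I : ModelWithCorners ℝ E H}
  {B : Type*} [TopologicalSpace B] [ChartedSpace H B] [IsManifold I ∞ B]
  {E' : Type*} [NormedAddCommGroup E'] [NormedSpace ℝ E']
  {H' : Type*} [TopologicalSpace H'] {J : ModelWithCorners ℝ E' H'}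
  {F : Type*} [TopologicalSpace F] [ChartedSpace H' F] [IsManifold J ∞ F]

/-- The bilinear form `g_B + f² g_F` on the tangent space of `B × F` at `p`, where `g_B` and `g_F`
are pulled back by the differentials of the two projections. -/
def warpedForm (gB : SmoothMetric I B) (gF : SmoothMetric J F) (f : B → ℝ) (p : B × F) :
    TangentSpace (I.prod J) p →L[ℝ] TangentSpace (I.prod J) p →L[ℝ] ℝ :=
  pullbackForm (gB.inner p.1) (mfderiv (I.prod J) I (Prod.fst : B × F → B) p)
    + f p.1 ^ 2 • pullbackForm (gF.inner p.2) (mfderiv (I.prod J) J (Prod.snd : B × F → F) p)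

theorem warpedForm_apply (gB : SmoothMetric I B) (gF : SmoothMetric J F) (f : B → ℝ) (p : B × F)
    (v w : TangentSpace (I.prod J) p) :
    warpedForm gB gF f p v w
      = gB.inner p.1 (mfderiv (I.prod J) I (Prod.fst : B × F → B) p v)
          (mfderiv (I.prod J) I (Prod.fst : B × F → B) p w)
        + f p.1 ^ 2 * gF.inner p.2 (mfderiv (I.prod J) J (Prod.snd : B × F → F) p v)
          (mfderiv (I.prod J) J (Prod.snd : B × F → F) p w) := rfl

/-- A field of bilinear forms on the tangent spaces, read in a trivialization. -/
theorem inCoordinates_form (b : ∀ x : B, TangentSpace I x →L[ℝ] TangentSpace I x →L[ℝ] ℝ)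
    {x₀ x : B} (hx : x ∈ (chartAt H x₀).source) :
    ContinuousLinearMap.inCoordinates E (fun x : B ↦ TangentSpace I x) (E →L[ℝ] ℝ)
      (fun x : B ↦ TangentSpace I x →L[ℝ] ℝ) x₀ x x₀ x (b x)
      = pullbackForm (b x) ((trivializationAt E (fun x : B ↦ TangentSpace I x) x₀).symmL ℝ x) := by
  ext v w
  have := inCoordinates_apply_eq₂ (𝕜 := ℝ) (E₁ := fun x : B ↦ TangentSpace I x)
    (E₂ := fun x : B ↦ TangentSpace I x) (E₃ := fun _ : B ↦ ℝ) (F₁ := E) (F₂ := E) (F₃ := ℝ)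
    (ϕ := b x) (x₀ := x₀) (x := x) (v := v) (w := w)
    (by simpa using hx) (by simpa using hx) (by simp)
  refine this.trans ?_
  rw [Trivialization.coe_linearMapAt_of_mem _ (by simp)]
  have e : ∀ u : E, (trivializationAt E (fun x : B ↦ TangentSpace I x) x₀).symmL ℝ x u
      = (trivializationAt E (fun x : B ↦ TangentSpace I x) x₀).symm x u :=
    fun u ↦ Trivialization.symmL_apply _ (by simpa using hx) u
  rw [pullbackForm_apply, e v, e w]
  rfl

/-- The trivializations of the tangent bundle of a product. -/
theorem symmL_prod {p₀ p : B × F} (h₁ : p.1 ∈ (chartAt H p₀.1).source)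
    (h₂ : p.2 ∈ (chartAt H' p₀.2).source) :
    (trivializationAt (E × E') (fun x : B × F ↦ TangentSpace (I.prod J) x) p₀).symmL ℝ p
      = ContinuousLinearMap.prodMap
          ((trivializationAt E (fun x : B ↦ TangentSpace I x) p₀.1).symmL ℝ p.1)
          ((trivializationAt E' (fun x : F ↦ TangentSpace J x) p₀.2).symmL ℝ p.2) := by
  rw [TangentBundle.symmL_trivializationAt_eq_core h₁,
    TangentBundle.symmL_trivializationAt_eq_core h₂,
    TangentBundle.symmL_trivializationAt_eq_core (by simp [h₁, h₂])]
  have hB := hasFDerivWithinAt_tangentCoordChange (I := I) (x := p₀.1) (y := p.1) (z := p.1)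
    (by simp [h₁])
  have hF := hasFDerivWithinAt_tangentCoordChange (I := J) (x := p₀.2) (y := p.2) (z := p.2)
    (by simp [h₂])
  have hp := hasFDerivWithinAt_tangentCoordChange (I := I.prod J) (x := p₀) (y := p) (z := p)
    (by simp [h₁, h₂])
  have hprod : HasFDerivWithinAt _ _ (range I ×ˢ range J)
      (extChartAt I p₀.1 p.1, extChartAt J p₀.2 p.2) :=
    HasFDerivWithinAt.prodMap (extChartAt I p₀.1 p.1, extChartAt J p₀.2 p.2)
      (hB.mono (fst_image_prod_subset _ _)) (hF.mono (snd_image_prod_subset _ _))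
  have hu : UniqueDiffWithinAt ℝ (range (I.prod J)) (extChartAt (I.prod J) p₀ p) :=
    (I.prod J).uniqueDiffOn _ (mem_range_self _)
  refine hu.eq hp ?_
  rw [ModelWithCorners.range_prod, extChartAt_prod, extChartAt_prod]
  exact hprod

theorem contMDiff_warpedForm (gB : SmoothMetric I B) (gF : SmoothMetric J F) {f : B → ℝ}
    (hf : ContMDiff I 𝓘(ℝ, ℝ) ∞ f) :
    ContMDiff (I.prod J) ((I.prod J).prod 𝓘(ℝ, (E × E') →L[ℝ] (E × E') →L[ℝ] ℝ)) ∞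
      (fun p : B × F ↦ TotalSpace.mk' ((E × E') →L[ℝ] (E × E') →L[ℝ] ℝ)
        (E := fun p : B × F ↦ TangentSpace (I.prod J) p →L[ℝ] TangentSpace (I.prod J) p →L[ℝ] ℝ)
        p (warpedForm gB gF f p)) := by
  intro p₀
  rw [contMDiffAt_hom_bundle]
  refine ⟨contMDiffAt_id, ?_⟩
  have hB := ((contMDiffAt_hom_bundle _).1 (gB.contMDiff p₀.1)).2.comp p₀
    (contMDiffAt_fst (I := I) (J := J) (n := ∞))
  have hF := ((contMDiffAt_hom_bundle _).1 (gF.contMDiff p₀.2)).2.comp p₀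
    (contMDiffAt_snd (I := I) (J := J) (n := ∞))
  have hf' := (hf p₀.1).comp p₀ (contMDiffAt_fst (I := I) (J := J) (n := ∞))
  have key := ((contMDiffAt_const (c := ContinuousLinearMap.precomp ℝ
      (ContinuousLinearMap.fst ℝ E E'))).clm_comp
      (hB.clm_comp (contMDiffAt_const (c := ContinuousLinearMap.fst ℝ E E')))).add
    ((hf'.pow 2).smul ((contMDiffAt_const (c := ContinuousLinearMap.precomp ℝ
      (ContinuousLinearMap.snd ℝ E E'))).clm_comp
      (hF.clm_comp (contMDiffAt_const (c := ContinuousLinearMap.snd ℝ E E')))))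
  refine key.congr_of_eventuallyEq ?_
  have h₁ : ∀ᶠ p : B × F in nhds p₀, p.1 ∈ (chartAt H p₀.1).source :=
    continuousAt_fst.eventually (chart_source_mem_nhds H p₀.1)
  have h₂ : ∀ᶠ p : B × F in nhds p₀, p.2 ∈ (chartAt H' p₀.2).source :=
    continuousAt_snd.eventually (chart_source_mem_nhds H' p₀.2)
  filter_upwards [h₁, h₂] with p h₁ h₂
  dsimp only [Function.comp_apply]
  refine (inCoordinates_form (warpedForm gB gF f) (x₀ := p₀) (x := p) (by simp [h₁, h₂])).trans ?_
  rw [symmL_prod h₁ h₂]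
  have eB := inCoordinates_form gB.inner h₁
  have eF := inCoordinates_form gF.inner h₂
  refine ContinuousLinearMap.ext fun v ↦ ContinuousLinearMap.ext fun w ↦ ?_
  have eB' := congrArg (fun b ↦ b v.1 w.1) eB
  have eF' := congrArg (fun b ↦ b v.2 w.2) eF
  refine (warpedForm_apply gB gF f p _ _).trans ?_
  rw [mfderiv_fst, mfderiv_snd]
  exact (congrArg₂ (fun a b : ℝ ↦ a + f p.1 ^ 2 * b) eB' eF').symm

/-- The warped metric `g_B + f² g_F` on `B × F`, where `f > 0`. -/
def warpedMetric (gB : SmoothMetric I B) (gF : SmoothMetric J F) (f : B → ℝ)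
    (hf : ContMDiff I 𝓘(ℝ, ℝ) ∞ f) (hpos : ∀ x, 0 < f x) : SmoothMetric (I.prod J) (B × F) where
  inner := warpedForm gB gF f
  symm p v w := by
    simp only [warpedForm_apply]
    rw [gB.symm, gF.symm]
  pos p v hv := by
    rw [warpedForm_apply, mfderiv_fst, mfderiv_snd]
    have hB : ∀ u, 0 ≤ gB.inner p.1 u u := fun u ↦ by
      rcases eq_or_ne u 0 with rfl | hu
      · simp
      · exact (gB.pos _ _ hu).le
    have hF : ∀ u, 0 ≤ gF.inner p.2 u u := fun u ↦ by
      rcases eq_or_ne u 0 with rfl | hu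
      · simp
      · exact (gF.pos _ _ hu).le
    have hfp := pow_pos (hpos p.1) 2
    obtain ⟨a, b⟩ := v
    change 0 < gB.inner p.1 a a + f p.1 ^ 2 * gF.inner p.2 b b
    by_cases ha : a = 0
    · have hb : b ≠ 0 := fun hb ↦ hv (by rw [ha, hb]; rfl)
      exact add_pos_of_nonneg_of_pos (hB a) (mul_pos hfp (gF.pos _ _ hb))
    · exact add_pos_of_pos_of_nonneg (gB.pos _ _ ha) (mul_nonneg hfp.le (hF b))
  isVonNBounded p := by
    have hB : ∀ u, 0 ≤ gB.inner p.1 u u := fun u ↦ by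
      rcases eq_or_ne u 0 with rfl | hu
      · simp
      · exact (gB.pos _ _ hu).le
    have hF : ∀ u, 0 ≤ gF.inner p.2 u u := fun u ↦ by
      rcases eq_or_ne u 0 with rfl | hu
      · simp
      · exact (gF.pos _ _ hu).le
    have hfp := hpos p.1
    let LB : TangentSpace I p.1 →L[ℝ] TangentSpace (I.prod J) p := ContinuousLinearMap.inl ℝ E E'
    let LF : TangentSpace J p.2 →L[ℝ] TangentSpace (I.prod J) p :=
      (f p.1)⁻¹ • ContinuousLinearMap.inr ℝ E E'
    refine (((gB.isVonNBounded p.1).image LB).add ((gF.isVonNBounded p.2).image LF)).subset ?_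
    intro v hv
    replace hv : warpedForm gB gF f p v v < 1 := hv
    rw [warpedForm_apply, mfderiv_fst, mfderiv_snd] at hv
    obtain ⟨a, b⟩ := v
    change gB.inner p.1 a a + f p.1 ^ 2 * gF.inner p.2 b b < 1 at hv
    refine Set.mem_add.2 ⟨LB a, ⟨a, ?_, rfl⟩, LF (f p.1 • b), ⟨f p.1 • b, ?_, rfl⟩, ?_⟩
    · have := mul_nonneg (pow_pos hfp 2).le (hF b)
      exact lt_of_le_of_lt (by linarith) hv
    · have := hB a
      have e : ∀ (c : ℝ) (u : TangentSpace J p.2),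
          gF.inner p.2 (c • u) (c • u) = c ^ 2 * gF.inner p.2 u u := fun c u ↦ by
        rw [map_smul, map_smul, smul_apply, smul_eq_mul, smul_eq_mul]; ring
      exact lt_of_eq_of_lt (e (f p.1) b) (by linarith)
    · change ((a, (0 : E')) + (f p.1)⁻¹ • ((0 : E), f p.1 • (b : E')) : E × E') = (a, b)
      ext
      · simp
      · simp [smul_smul, hfp.ne']
  contMDiff := contMDiff_warpedForm gB gF hf

end Warped

/-! ### The conditions on the base and on the fiber -/

section Conditions

variable {n m : ℕ}
  {B : Type*} [TopologicalSpace B] [ChartedSpace (EuclideanSpace ℝ (Fin n)) B]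
  [IsManifold (𝓡 n) ∞ B]
  {F : Type*} [TopologicalSpace F] [ChartedSpace (EuclideanSpace ℝ (Fin m)) F]
  [IsManifold (𝓡 m) ∞ F]

/-- The equation `α Ric_B + β ∇²h + μ dh ⊗ dh = (α m / f) ∇²f + (ρ R_g + lam) g_B` on the base, where
`R_g` is the scalar curvature of the warped metric `g`. Since `R_g` is a function on `B × F`, the
equation is required at each point of `B` and for the value of `R_g` at each point above it. -/
def BaseCondition (gB : SmoothMetric (𝓡 n) B) (g : SmoothMetric ((𝓡 n).prod (𝓡 m)) (B × F))
    (f : B → ℝ) (α β μ ρ : ℝ) (h lam : B → ℝ) : Prop :=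
  ∀ (x : B) (y : F) (v w : TangentSpace (𝓡 n) x),
    α * ricci gB x v w + β * hessian gB h x v w
        + μ * (differential (𝓡 n) h x v * differential (𝓡 n) h x w)
      = α * m / f x * hessian gB f x v w
        + (ρ * scalarCurvature g (x, y) + lam x) * gB.inner x v w

/-- The scalar identity
`(α/m - ρ) R_F = ρ R_B f² + lam f² + (α - 2mρ) f Δf - β f ∇h(f) + (m - 1)(α - mρ) |∇f|²`
at all points of the base and of the fiber, and the constancy of `R_F`. In the degenerate case
`α = ρ = 0` the curvature of the fiber occurs neither in the identity nor in the equation on the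
product, and nothing is asked of it. -/
def FiberCondition (gB : SmoothMetric (𝓡 n) B) (gF : SmoothMetric (𝓡 m) F)
    (f : B → ℝ) (α β ρ : ℝ) (h lam : B → ℝ) : Prop :=
  ((α, ρ) ≠ (0, 0) → ∃ c : ℝ, ∀ y : F, scalarCurvature gF y = c) ∧
    ∀ (x : B) (y : F),
      (α / m - ρ) * scalarCurvature gF y
        = ρ * scalarCurvature gB x * f x ^ 2 + lam x * f x ^ 2
          + (α - 2 * m * ρ) * f x * laplacian gB f x
          - β * f x * differential (𝓡 n) f x (gradient gB h x)
          + (m - 1) * (α - m * ρ) * gB.inner x (gradient gB f x) (gradient gB f x)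

end Conditions

end WarpedEinstein

end

noncomputable section

namespace WarpedEinstein

section LinearAlgebra

theorem trace_prod {V W : Type*} [AddCommGroup V] [Module ℝ V] [AddCommGroup W] [Module ℝ W]
    [FiniteDimensional ℝ V] [FiniteDimensional ℝ W] (T : V × W →ₗ[ℝ] V × W) :
    LinearMap.trace ℝ (V × W) T
      = LinearMap.trace ℝ V (LinearMap.fst ℝ V W ∘ₗ T ∘ₗ LinearMap.inl ℝ V W)
        + LinearMap.trace ℝ W (LinearMap.snd ℝ V W ∘ₗ T ∘ₗ LinearMap.inr ℝ V W) := by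
  have hT : T = LinearMap.inl ℝ V W ∘ₗ (LinearMap.fst ℝ V W ∘ₗ T)
      + LinearMap.inr ℝ V W ∘ₗ (LinearMap.snd ℝ V W ∘ₗ T) := by
    refine LinearMap.ext fun v ↦ ?_
    simp
  conv_lhs => rw [hT, map_add]
  rw [LinearMap.trace_comp_comm' (LinearMap.fst ℝ V W ∘ₗ T),
    LinearMap.trace_comp_comm' (LinearMap.snd ℝ V W ∘ₗ T)]
  rfl

variable {V W : Type*} [NormedAddCommGroup V] [NormedSpace ℝ V]
  [NormedAddCommGroup W] [NormedSpace ℝ W]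

theorem isInvertible_of_injective [FiniteDimensional ℝ V] {g : V →L[ℝ] V →L[ℝ] ℝ}
    (hg : ∀ v, g v = 0 → v = 0) : g.IsInvertible := by
  have hinj : Function.Injective (g : V →ₗ[ℝ] V →L[ℝ] ℝ) :=
    (injective_iff_map_eq_zero _).2 hg
  have hd : Module.finrank ℝ V = Module.finrank ℝ (V →L[ℝ] ℝ) := by
    rw [← (LinearMap.toContinuousLinearMap (𝕜 := ℝ) (E := V) (F' := ℝ)).finrank_eq]
    exact (Subspace.dual_finrank_eq (K := ℝ) (V := V)).symm
  refine ⟨(LinearEquiv.ofInjectiveOfFinrankEq (g : V →ₗ[ℝ] V →L[ℝ] ℝ) hinj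
    hd).toContinuousLinearEquiv, ?_⟩
  ext v w
  rfl

theorem metricTrace_add (g S T : V →L[ℝ] V →L[ℝ] ℝ) :
    metricTrace g (S + T) = metricTrace g S + metricTrace g T := by
  simp only [metricTrace, ContinuousLinearMap.comp_add, ContinuousLinearMap.toLinearMap_add,
    map_add]

theorem metricTrace_smul (g T : V →L[ℝ] V →L[ℝ] ℝ) (c : ℝ) :
    metricTrace g (c • T) = c * metricTrace g T := by
  simp only [metricTrace, ContinuousLinearMap.comp_smul, ContinuousLinearMap.toLinearMap_smul,
    map_smul, smul_eq_mul]

theorem metricTrace_self [FiniteDimensional ℝ V] {g : V →L[ℝ] V →L[ℝ] ℝ} (hg : g.IsInvertible) :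
    metricTrace g g = Module.finrank ℝ V := by
  rw [metricTrace, hg.inverse_comp_self]
  exact LinearMap.trace_id ℝ V

/-- The linear map that sends a bilinear form to its pullback along `L`. -/
def pullbackFormL (L : V →L[ℝ] W) : (W →L[ℝ] W →L[ℝ] ℝ) →L[ℝ] (V →L[ℝ] V →L[ℝ] ℝ) :=
  (ContinuousLinearMap.postcomp V (ContinuousLinearMap.precomp ℝ L)).comp
    (ContinuousLinearMap.precomp (W →L[ℝ] ℝ) L)

@[simp] theorem pullbackFormL_apply (L : V →L[ℝ] W) (b : W →L[ℝ] W →L[ℝ] ℝ) :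
    pullbackFormL L b = pullbackForm b L := rfl

/-- The form `g + c k` on a product. -/
def sumForm (g : V →L[ℝ] V →L[ℝ] ℝ) (k : W →L[ℝ] W →L[ℝ] ℝ) (c : ℝ) :
    V × W →L[ℝ] V × W →L[ℝ] ℝ :=
  pullbackForm g (ContinuousLinearMap.fst ℝ V W) + c • pullbackForm k (ContinuousLinearMap.snd ℝ V W)

@[simp] theorem sumForm_apply (g : V →L[ℝ] V →L[ℝ] ℝ) (k : W →L[ℝ] W →L[ℝ] ℝ) (c : ℝ)
    (v w : V × W) : sumForm g k c v w = g v.1 w.1 + c * k v.2 w.2 := rfl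

theorem sumForm_equation_iff (α β μ c m s t φ : ℝ) (rB hB hf gB : V →L[ℝ] V →L[ℝ] ℝ)
    (rF gF : W →L[ℝ] W →L[ℝ] ℝ) (η : V →L[ℝ] ℝ) :
    (∀ v w : V × W, α * sumForm (rB - (m / φ) • hf) (rF - s • gF) 1 v w
        + β * sumForm hB (t • gF) 1 v w + μ * (η v.1 * η w.1) = c * sumForm gB gF (φ ^ 2) v w) ↔
      (∀ v w : V, α * rB v w + β * hB v w + μ * (η v * η w)
        = α * m / φ * hf v w + c * gB v w) ∧
      ∀ v w : W, α * rF v w = (α * s - β * t + c * φ ^ 2) * gF v w := by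
  simp only [sumForm_apply, sub_apply, smul_apply, smul_eq_mul]
  refine ⟨fun H ↦ ⟨fun v w ↦ ?_, fun v w ↦ ?_⟩, fun H v w ↦ ?_⟩
  · have := H (v, 0) (w, 0)
    simp only [map_zero, mul_zero] at this
    linear_combination this
  · have := H (0, v) (0, w)
    simp only [map_zero, mul_zero] at this
    linear_combination this
  · linear_combination H.1 v.1 w.1 + H.2 v.2 w.2

variable [FiniteDimensional ℝ V] [FiniteDimensional ℝ W]

theorem isInvertible_sumForm {g : V →L[ℝ] V →L[ℝ] ℝ} {k : W →L[ℝ] W →L[ℝ] ℝ} {c : ℝ}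
    (hg : g.IsInvertible) (hk : k.IsInvertible) (hc : c ≠ 0) : (sumForm g k c).IsInvertible := by
  refine isInvertible_of_injective fun v hv ↦ ?_
  have h (w : V × W) : g v.1 w.1 + c * k v.2 w.2 = 0 := by
    rw [← sumForm_apply, hv]; rfl
  have h1 : v.1 = 0 := hg.injective <| by
    ext w
    simpa using h (w, 0)
  have h2 : v.2 = 0 := hk.injective <| by
    ext w
    simpa [hc] using h (0, w)
  exact Prod.ext h1 h2

theorem metricTrace_sumForm {g S : V →L[ℝ] V →L[ℝ] ℝ} {k T : W →L[ℝ] W →L[ℝ] ℝ} {c : ℝ}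
    (hg : g.IsInvertible) (hk : k.IsInvertible) (hc : c ≠ 0) :
    metricTrace (sumForm g k c) (sumForm S T 1) = metricTrace g S + c⁻¹ * metricTrace k T := by
  have key (v : V × W) : (sumForm g k c).inverse (sumForm S T 1 v)
      = (g.inverse (S v.1), c⁻¹ • k.inverse (T v.2)) := by
    rw [(isInvertible_sumForm hg hk hc).inverse_apply_eq]
    ext w <;> simp [hg.self_apply_inverse, hk.self_apply_inverse, hc]
  rw [metricTrace, trace_prod, metricTrace, metricTrace, ← smul_eq_mul, ← map_smul]
  congr 2
  · ext v
    exact congrArg Prod.fst (key (v, 0))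
  · ext v
    exact congrArg Prod.snd (key (0, v))

theorem metricTrace_sumForm_sub {g S S' : V →L[ℝ] V →L[ℝ] ℝ} {k T : W →L[ℝ] W →L[ℝ] ℝ} {c : ℝ}
    (hg : g.IsInvertible) (hk : k.IsInvertible) (hc : c ≠ 0) (a b : ℝ) :
    metricTrace (sumForm g k c) (sumForm (S - a • S') (T - b • k) 1)
      = metricTrace g S - a * metricTrace g S'
        + c⁻¹ * (metricTrace k T - b * Module.finrank ℝ W) := by
  rw [metricTrace_sumForm hg hk hc, sub_eq_add_neg, sub_eq_add_neg, ← neg_smul, ← neg_smul,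
    metricTrace_add, metricTrace_add, metricTrace_smul, metricTrace_smul, metricTrace_self hk]
  ring

theorem mul_metricTrace_of_smul_eq {g T : V →L[ℝ] V →L[ℝ] ℝ} (hg : g.IsInvertible) {a c : ℝ}
    (h : ∀ v w, a * T v w = c * g v w) : a * metricTrace g T = c * Module.finrank ℝ V := by
  have h' : a • T = c • g :=
    ContinuousLinearMap.ext fun v ↦ ContinuousLinearMap.ext fun w ↦ h v w
  rw [← metricTrace_smul, h', metricTrace_smul, metricTrace_self hg]

end LinearAlgebra

section Coordinates

variable {E : Type*} [NormedAddCommGroup E] [NormedSpace ℝ E]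

/-- Near `u`, `G` is a field of nondegenerate symmetric forms of class `C²`. -/
structure IsMetricAt (G : E → E →L[ℝ] E →L[ℝ] ℝ) (u : E) : Prop where
  contDiffAt : ContDiffAt ℝ 2 G u
  symm : ∀ᶠ x in nhds u, ∀ v w, G x v w = G x w v
  isInvertible : ∀ᶠ x in nhds u, (G x).IsInvertible

namespace IsMetricAt

variable {G : E → E →L[ℝ] E →L[ℝ] ℝ} {u : E}

theorem eventually (hG : IsMetricAt G u) : ∀ᶠ x in nhds u, IsMetricAt G x := by
  filter_upwards [hG.contDiffAt.eventually (by simp), hG.symm.eventually_nhds,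
    hG.isInvertible.eventually_nhds] with x h1 h2 h3
  exact ⟨h1, h2, h3⟩

theorem invertible (hG : IsMetricAt G u) : (G u).IsInvertible := hG.isInvertible.self_of_nhds

theorem symm_apply (hG : IsMetricAt G u) (v w : E) : G u v w = G u w v :=
  hG.symm.self_of_nhds v w

theorem hasFDerivAt (hG : IsMetricAt G u) : HasFDerivAt G (fderiv ℝ G u) u :=
  (hG.contDiffAt.differentiableAt (by simp)).hasFDerivAt

theorem fderiv_symm (hG : IsMetricAt G u) (v w z : E) :
    fderiv ℝ G u v w z = fderiv ℝ G u v z w := by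
  have h1 := (hG.hasFDerivAt.clm_apply (hasFDerivAt_const w u)).clm_apply (hasFDerivAt_const z u)
  have h2 := (hG.hasFDerivAt.clm_apply (hasFDerivAt_const z u)).clm_apply (hasFDerivAt_const w u)
  have h3 : (fun x ↦ G x w z) =ᶠ[nhds u] fun x ↦ G x z w := by
    filter_upwards [hG.symm] with x hx
    exact hx w z
  have := congrArg (fun L : E →L[ℝ] ℝ ↦ L v) ((h2.congr_of_eventuallyEq h3).unique h1)
  simpa using this.symm

theorem inner_christoffel (hG : IsMetricAt G u) (v w z : E) :
    G u (christoffel G u v w) z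
      = 1 / 2 * (fderiv ℝ G u v w z + fderiv ℝ G u w v z - fderiv ℝ G u z v w) := by
  rw [christoffel_apply, hG.invertible.self_apply_inverse]
  rfl

theorem christoffel_comm (hG : IsMetricAt G u) (v w : E) :
    christoffel G u v w = christoffel G u w v := by
  refine hG.invertible.injective (ContinuousLinearMap.ext fun z ↦ ?_)
  rw [hG.inner_christoffel, hG.inner_christoffel, hG.fderiv_symm z v w]
  ring

theorem fderiv_eq (hG : IsMetricAt G u) (v w z : E) :
    fderiv ℝ G u v w z = G u (christoffel G u v w) z + G u w (christoffel G u v z) := by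
  rw [hG.symm_apply w, hG.inner_christoffel, hG.inner_christoffel, hG.fderiv_symm w v z,
    hG.fderiv_symm z v w, hG.fderiv_symm v z w]
  ring

variable [FiniteDimensional ℝ E]

theorem contDiffAt_inverse (hG : IsMetricAt G u) :
    ContDiffAt ℝ 2 (fun x ↦ (G x).inverse) u :=
  ContDiffAt.comp u (g := ContinuousLinearMap.inverse) hG.invertible.contDiffAt_map_inverse
    hG.contDiffAt

theorem differentiableAt_christoffel (hG : IsMetricAt G u) :
    DifferentiableAt ℝ (christoffel G) u := by
  have h1 : DifferentiableAt ℝ (fderiv ℝ G) u :=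
    (hG.contDiffAt.fderiv_right (m := 1) (by norm_num)).differentiableAt (by simp)
  have h2 : DifferentiableAt ℝ (fun x ↦ (G x).inverse) u :=
    hG.contDiffAt_inverse.differentiableAt (by simp)
  have hflip : DifferentiableAt ℝ (fun x ↦ (fderiv ℝ G x).flip) u :=
    (ContinuousLinearMap.flipₗᵢ ℝ E E (E →L[ℝ] ℝ)).toContinuousLinearEquiv.differentiableAt.comp
      u h1
  unfold christoffel
  refine DifferentiableAt.clm_comp ?_ (DifferentiableAt.fun_const_smul (.fun_sub (.fun_add h1 hflip)
    (.clm_comp (differentiableAt_const _) hflip)) _)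
  exact (ContinuousLinearMap.compL ℝ E (E →L[ℝ] ℝ) E).differentiableAt.comp u h2

end IsMetricAt

end Coordinates

section CoordinateGradient

variable {E : Type*} [NormedAddCommGroup E] [NormedSpace ℝ E]
  {G : E → E →L[ℝ] E →L[ℝ] ℝ} {φ ψ : E → ℝ} {u : E}

/-- The gradient of `φ` in the metric `G`. -/
def coordGradient (G : E → E →L[ℝ] E →L[ℝ] ℝ) (φ : E → ℝ) (u : E) : E :=
  sharp (G u) (fderiv ℝ φ u)

theorem IsMetricAt.inner_coordGradient (hG : IsMetricAt G u) (φ : E → ℝ) (v : E) :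
    G u (coordGradient G φ u) v = fderiv ℝ φ u v := by
  rw [coordGradient, sharp, hG.invertible.self_apply_inverse]

theorem IsMetricAt.fderiv_coordGradient_comm (hG : IsMetricAt G u) (φ ψ : E → ℝ) :
    fderiv ℝ φ u (coordGradient G ψ u) = fderiv ℝ ψ u (coordGradient G φ u) := by
  rw [← hG.inner_coordGradient, ← hG.inner_coordGradient, hG.symm_apply]

theorem hasFDerivAt_fderiv (hφ : ContDiffAt ℝ 2 φ u) :
    HasFDerivAt (fderiv ℝ φ) (fderiv ℝ (fderiv ℝ φ) u) u :=
  ((hφ.fderiv_right (m := 1) (by norm_num)).differentiableAt (by simp)).hasFDerivAt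

variable [FiniteDimensional ℝ E]

theorem IsMetricAt.differentiableAt_coordGradient (hG : IsMetricAt G u)
    (hφ : ContDiffAt ℝ 2 φ u) : DifferentiableAt ℝ (coordGradient G φ) u :=
  (hG.contDiffAt_inverse.differentiableAt (by simp)).clm_apply
    (hasFDerivAt_fderiv hφ).differentiableAt

/-- The covariant derivative of the gradient is the endomorphism dual to the Hessian. -/
theorem IsMetricAt.inverse_coordHessian (hG : IsMetricAt G u) (hφ : ContDiffAt ℝ 2 φ u) (v : E) :
    (G u).inverse (coordHessian G φ u v)
      = fderiv ℝ (coordGradient G φ) u v + christoffel G u v (coordGradient G φ u) := by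
  rw [hG.invertible.inverse_apply_eq]
  ext z
  have h1 := (hG.hasFDerivAt.clm_apply
    (hG.differentiableAt_coordGradient hφ).hasFDerivAt).clm_apply (hasFDerivAt_const z u)
  have h2 := (hasFDerivAt_fderiv hφ).clm_apply (hasFDerivAt_const z u)
  have h3 : (fun x ↦ fderiv ℝ φ x z) =ᶠ[nhds u] fun x ↦ G x (coordGradient G φ x) z := by
    filter_upwards [hG.eventually] with x hx
    exact (hx.inner_coordGradient φ z).symm
  have h4 := congrArg (fun L : E →L[ℝ] ℝ ↦ L v) (h2.unique (h1.congr_of_eventuallyEq h3))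
  simp only [ContinuousLinearMap.comp_zero, zero_add, add_apply, ContinuousLinearMap.comp_apply,
    ContinuousLinearMap.flip_apply] at h4
  rw [coordHessian_apply, h4, hG.fderiv_eq v, ← hG.inner_coordGradient, map_add, add_apply]
  ring

end CoordinateGradient

section WarpedCoordinates

variable {E : Type*} [NormedAddCommGroup E] [NormedSpace ℝ E]
  {E' : Type*} [NormedAddCommGroup E'] [NormedSpace ℝ E']
  {G : E → E →L[ℝ] E →L[ℝ] ℝ} {K : E' → E' →L[ℝ] E' →L[ℝ] ℝ} {φ ψ : E → ℝ} {u : E × E'}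

/-- The warped metric `G + φ² K`. -/
def coordWarped (G : E → E →L[ℝ] E →L[ℝ] ℝ) (K : E' → E' →L[ℝ] E' →L[ℝ] ℝ) (φ : E → ℝ)
    (u : E × E') : E × E' →L[ℝ] E × E' →L[ℝ] ℝ :=
  sumForm (G u.1) (K u.2) (φ u.1 ^ 2)

theorem fderiv_coordWarped_apply (hG : IsMetricAt G u.1) (hK : IsMetricAt K u.2)
    (hφ : ContDiffAt ℝ 2 φ u.1) (v w z : E × E') :
    fderiv ℝ (coordWarped G K φ) u v w z
      = fderiv ℝ G u.1 v.1 w.1 z.1 + φ u.1 ^ 2 * fderiv ℝ K u.2 v.2 w.2 z.2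
        + 2 * φ u.1 * fderiv ℝ φ u.1 v.1 * K u.2 w.2 z.2 := by
  have h1 := (pullbackFormL (ContinuousLinearMap.fst ℝ E E')).hasFDerivAt.comp u
    (hG.hasFDerivAt.comp u (hasFDerivAt_fst (𝕜 := ℝ)))
  have h2 := (pullbackFormL (ContinuousLinearMap.snd ℝ E E')).hasFDerivAt.comp u
    (hK.hasFDerivAt.comp u (hasFDerivAt_snd (𝕜 := ℝ)))
  have h3 := ((hφ.differentiableAt (by simp)).hasFDerivAt.comp u
    (hasFDerivAt_fst (𝕜 := ℝ))).pow 2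
  have h : HasFDerivAt (coordWarped G K φ) _ u := h1.add (h3.smul h2)
  rw [h.fderiv]
  simp
  ring

variable [FiniteDimensional ℝ E] [FiniteDimensional ℝ E']

theorem isMetricAt_coordWarped (hG : IsMetricAt G u.1) (hK : IsMetricAt K u.2)
    (hφ : ContDiffAt ℝ 2 φ u.1) (h0 : φ u.1 ≠ 0) : IsMetricAt (coordWarped G K φ) u where
  contDiffAt := by
    refine ((pullbackFormL (ContinuousLinearMap.fst ℝ E E')).contDiff.contDiffAt.comp u
      (hG.contDiffAt.comp u contDiffAt_fst)).add (((hφ.comp u contDiffAt_fst).pow 2).smul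
      ((pullbackFormL (ContinuousLinearMap.snd ℝ E E')).contDiff.contDiffAt.comp u
        (hK.contDiffAt.comp u contDiffAt_snd)))
  symm := by
    filter_upwards [continuousAt_fst.eventually hG.symm, continuousAt_snd.eventually hK.symm]
      with x h1 h2 v w
    simp [coordWarped, h1 v.1, h2 v.2]
  isInvertible := by
    filter_upwards [continuousAt_fst.eventually hG.isInvertible,
      continuousAt_snd.eventually hK.isInvertible,
      continuousAt_fst.eventually (hφ.continuousAt.eventually_ne h0)] with x h1 h2 h3
    exact isInvertible_sumForm h1 h2 (pow_ne_zero 2 h3)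

theorem christoffel_coordWarped (hG : IsMetricAt G u.1) (hK : IsMetricAt K u.2)
    (hφ : ContDiffAt ℝ 2 φ u.1) (h0 : φ u.1 ≠ 0) (v w : E × E') :
    christoffel (coordWarped G K φ) u v w
      = (christoffel G u.1 v.1 w.1 - (φ u.1 * K u.2 v.2 w.2) • coordGradient G φ u.1,
        christoffel K u.2 v.2 w.2 + (φ u.1)⁻¹ •
          (fderiv ℝ φ u.1 v.1 • w.2 + fderiv ℝ φ u.1 w.1 • v.2)) := by
  have hW := isMetricAt_coordWarped hG hK hφ h0
  refine hW.invertible.injective (ContinuousLinearMap.ext fun z ↦ ?_)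
  rw [hW.inner_christoffel]
  simp only [fderiv_coordWarped_apply hG hK hφ]
  simp only [coordWarped, sumForm_apply, map_sub, map_add, map_smul, sub_apply, add_apply,
    smul_apply, smul_eq_mul, hG.inner_christoffel, hK.inner_christoffel, hG.inner_coordGradient]
  field_simp
  ring

theorem fderiv_christoffel_coordWarped (hG : IsMetricAt G u.1) (hK : IsMetricAt K u.2)
    (hφ : ContDiffAt ℝ 2 φ u.1) (h0 : φ u.1 ≠ 0) (v w z : E × E') :
    fderiv ℝ (christoffel (coordWarped G K φ)) u v w z
      = (fderiv ℝ (christoffel G) u.1 v.1 w.1 z.1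
          - (fderiv ℝ φ u.1 v.1 * K u.2 w.2 z.2 + φ u.1 * fderiv ℝ K u.2 v.2 w.2 z.2)
            • coordGradient G φ u.1
          - (φ u.1 * K u.2 w.2 z.2) • fderiv ℝ (coordGradient G φ) u.1 v.1,
        fderiv ℝ (christoffel K) u.2 v.2 w.2 z.2
          + (φ u.1)⁻¹ • (fderiv ℝ (fderiv ℝ φ) u.1 v.1 w.1 • z.2
            + fderiv ℝ (fderiv ℝ φ) u.1 v.1 z.1 • w.2)
          - (fderiv ℝ φ u.1 v.1 / φ u.1 ^ 2) • (fderiv ℝ φ u.1 w.1 • z.2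
            + fderiv ℝ φ u.1 z.1 • w.2)) := by
  have hW := isMetricAt_coordWarped hG hK hφ h0
  have hfst := hasFDerivAt_fst (𝕜 := ℝ) (p := u)
  have hsnd := hasFDerivAt_snd (𝕜 := ℝ) (p := u)
  have hl := (hW.differentiableAt_christoffel.hasFDerivAt.clm_apply
    (hasFDerivAt_const w u)).clm_apply (hasFDerivAt_const z u)
  have hΓ := ((hG.differentiableAt_christoffel.hasFDerivAt.comp u hfst).clm_apply
    (hasFDerivAt_const w.1 u)).clm_apply (hasFDerivAt_const z.1 u)
  have hΓ' := ((hK.differentiableAt_christoffel.hasFDerivAt.comp u hsnd).clm_apply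
    (hasFDerivAt_const w.2 u)).clm_apply (hasFDerivAt_const z.2 u)
  have hK' := ((hK.hasFDerivAt.comp u hsnd).clm_apply
    (hasFDerivAt_const w.2 u)).clm_apply (hasFDerivAt_const z.2 u)
  have hφ' := (hφ.differentiableAt (by simp)).hasFDerivAt.comp u hfst
  have hN := (hG.differentiableAt_coordGradient hφ).hasFDerivAt.comp u hfst
  have hd (x : E) := ((hasFDerivAt_fderiv hφ).comp u hfst).clm_apply (hasFDerivAt_const x u)
  have hinv := (hasFDerivAt_inv h0).comp u hφ'
  have hr := (hΓ.sub ((hφ'.mul hK').smul hN)).prodMk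
    (hΓ'.add (hinv.smul (((hd w.1).smul_const z.2).add ((hd z.1).smul_const w.2))))
  have he := hl.unique (hr.congr_of_eventuallyEq (by
    filter_upwards [continuousAt_fst.eventually hG.eventually,
      continuousAt_snd.eventually hK.eventually,
      continuousAt_fst.eventually (hφ.eventually (by simp)),
      continuousAt_fst.eventually (hφ.continuousAt.eventually_ne h0)] with x h1 h2 h3 h4
    exact christoffel_coordWarped h1 h2 h3 h4 w z))
  have := congrArg (fun L : E × E' →L[ℝ] E × E' ↦ L v) he
  simp only [ContinuousLinearMap.comp_zero, zero_add, ContinuousLinearMap.flip_apply] at this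
  rw [this]
  ext
  · simp
    module
  · simp
    module

theorem curvature_coordWarped_fst (hG : IsMetricAt G u.1) (hK : IsMetricAt K u.2)
    (hφ : ContDiffAt ℝ 2 φ u.1) (h0 : φ u.1 ≠ 0) (w z : E × E') (v : E) :
    (curvature (coordWarped G K φ) u w z (v, 0)).1
      = curvature G u.1 w.1 z.1 v
        - (φ u.1 * K u.2 w.2 z.2) • (G u.1).inverse (coordHessian G φ u.1 v) := by
  simp only [curvature_apply, fderiv_christoffel_coordWarped hG hK hφ h0,
    christoffel_coordWarped hG hK hφ h0, hG.inverse_coordHessian hφ, Prod.fst_sub, Prod.fst_add,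
    map_zero, map_add, map_sub, map_smul, zero_apply, smul_zero, add_zero, zero_add, mul_zero,
    zero_smul, sub_zero, smul_eq_mul]
  match_scalars <;> field_simp
  ring

theorem curvature_coordWarped_snd (hG : IsMetricAt G u.1) (hK : IsMetricAt K u.2)
    (hφ : ContDiffAt ℝ 2 φ u.1) (h0 : φ u.1 ≠ 0) (w z : E × E') (v : E') :
    (curvature (coordWarped G K φ) u w z (0, v)).2
      = curvature K u.2 w.2 z.2 v - ((φ u.1)⁻¹ * coordHessian G φ u.1 w.1 z.1) • v
        - fderiv ℝ φ u.1 (coordGradient G φ u.1) • (K u.2 w.2 z.2 • v - K u.2 v z.2 • w.2) := by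
  simp only [curvature_apply, fderiv_christoffel_coordWarped hG hK hφ h0,
    christoffel_coordWarped hG hK hφ h0, coordHessian_apply, Prod.snd_sub, Prod.snd_add,
    map_zero, map_add, map_sub, map_smul, zero_apply, smul_zero, add_zero, zero_add,
    zero_smul, sub_zero, zero_sub, smul_eq_mul, zero_div, map_neg, neg_smul]
  rw [hK.christoffel_comm v w.2]
  match_scalars <;> field_simp <;> ring

theorem coordRicci_apply (G : E → E →L[ℝ] E →L[ℝ] ℝ) (x w z : E) :
    coordRicci G x w z = LinearMap.trace ℝ E (curvature G x w z : E →ₗ[ℝ] E) := rfl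

theorem coordRicci_coordWarped (hG : IsMetricAt G u.1) (hK : IsMetricAt K u.2)
    (hφ : ContDiffAt ℝ 2 φ u.1) (h0 : φ u.1 ≠ 0) :
    coordRicci (coordWarped G K φ) u
      = sumForm (coordRicci G u.1 - (Module.finrank ℝ E' / φ u.1) • coordHessian G φ u.1)
          (coordRicci K u.2 - (φ u.1 * metricTrace (G u.1) (coordHessian G φ u.1)
            + (Module.finrank ℝ E' - 1) * fderiv ℝ φ u.1 (coordGradient G φ u.1)) • K u.2) 1 := by
  refine ContinuousLinearMap.ext fun w ↦ ContinuousLinearMap.ext fun z ↦ ?_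
  have h1 : LinearMap.fst ℝ E E' ∘ₗ
      (curvature (coordWarped G K φ) u w z : E × E' →ₗ[ℝ] E × E') ∘ₗ LinearMap.inl ℝ E E'
      = (curvature G u.1 w.1 z.1 : E →ₗ[ℝ] E) - (φ u.1 * K u.2 w.2 z.2) •
        ((G u.1).inverse.comp (coordHessian G φ u.1) : E →L[ℝ] E) :=
    LinearMap.ext (curvature_coordWarped_fst hG hK hφ h0 w z)
  have h2 : LinearMap.snd ℝ E E' ∘ₗ
      (curvature (coordWarped G K φ) u w z : E × E' →ₗ[ℝ] E × E') ∘ₗ LinearMap.inr ℝ E E'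
      = (curvature K u.2 w.2 z.2 : E' →ₗ[ℝ] E')
        - ((φ u.1)⁻¹ * coordHessian G φ u.1 w.1 z.1) • LinearMap.id
        - fderiv ℝ φ u.1 (coordGradient G φ u.1) • (K u.2 w.2 z.2 • LinearMap.id
          - LinearMap.smulRight ((K u.2).flip z.2 : E' →ₗ[ℝ] ℝ) w.2) :=
    LinearMap.ext (curvature_coordWarped_snd hG hK hφ h0 w z)
  rw [coordRicci_apply, trace_prod, h1, h2]
  simp only [map_sub, map_smul, LinearMap.trace_id, LinearMap.trace_smulRight, sumForm_apply,
    sub_apply, smul_apply, smul_eq_mul, coordRicci_apply, metricTrace,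
    ContinuousLinearMap.coe_coe, ContinuousLinearMap.flip_apply]
  ring

theorem coordHessian_coordWarped (hG : IsMetricAt G u.1) (hK : IsMetricAt K u.2)
    (hφ : ContDiffAt ℝ 2 φ u.1) (h0 : φ u.1 ≠ 0) (hψ : ContDiffAt ℝ 2 ψ u.1) :
    coordHessian (coordWarped G K φ) (ψ ∘ Prod.fst) u
      = sumForm (coordHessian G ψ u.1)
          ((φ u.1 * fderiv ℝ φ u.1 (coordGradient G ψ u.1)) • K u.2) 1 := by
  have h1 (x : E × E') (hx : ContDiffAt ℝ 2 ψ x.1) : HasFDerivAt (ψ ∘ Prod.fst)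
      ((fderiv ℝ ψ x.1).comp (ContinuousLinearMap.fst ℝ E E')) x :=
    (hx.differentiableAt (by simp)).hasFDerivAt.comp x hasFDerivAt_fst
  have h2 : fderiv ℝ (ψ ∘ Prod.fst)
      =ᶠ[nhds u] fun x ↦ (fderiv ℝ ψ x.1).comp (ContinuousLinearMap.fst ℝ E E') := by
    filter_upwards [continuousAt_fst.eventually (hψ.eventually (by simp))] with x hx
    exact (h1 x hx).fderiv
  have h3 := (((hasFDerivAt_fderiv hψ).comp u (hasFDerivAt_fst (𝕜 := ℝ))).clm_comp
    (hasFDerivAt_const (ContinuousLinearMap.fst ℝ E E') u)).congr_of_eventuallyEq h2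
  refine ContinuousLinearMap.ext fun v ↦ ContinuousLinearMap.ext fun w ↦ ?_
  rw [coordHessian_apply, h3.fderiv, (h1 u hψ).fderiv, christoffel_coordWarped hG hK hφ h0,
    hG.fderiv_coordGradient_comm φ ψ]
  simp [coordHessian_apply]
  ring

end WarpedCoordinates

section Germs

variable {E : Type*} [NormedAddCommGroup E] [NormedSpace ℝ E]
  {G G' : E → E →L[ℝ] E →L[ℝ] ℝ} {u : E}

theorem christoffel_congr (h : G =ᶠ[nhds u] G') : christoffel G u = christoffel G' u := by
  unfold christoffel
  rw [h.fderiv_eq, h.self_of_nhds]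

theorem coordHessian_congr (h : G =ᶠ[nhds u] G') (φ : E → ℝ) :
    coordHessian G φ u = coordHessian G' φ u := by
  unfold coordHessian
  rw [christoffel_congr h]

theorem coordRicci_congr [FiniteDimensional ℝ E] (h : G =ᶠ[nhds u] G') :
    coordRicci G u = coordRicci G' u := by
  have h' : christoffel G =ᶠ[nhds u] christoffel G' :=
    h.eventually_nhds.mono fun x hx ↦ christoffel_congr hx
  refine ContinuousLinearMap.ext fun w ↦ ContinuousLinearMap.ext fun z ↦ ?_
  rw [coordRicci_apply, coordRicci_apply]
  unfold curvature
  rw [h'.fderiv_eq, h'.self_of_nhds]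

end Germs

section Charts

variable {E : Type*} [NormedAddCommGroup E] [NormedSpace ℝ E]
  {H : Type*} [TopologicalSpace H] {I : ModelWithCorners ℝ E H}
  {M : Type*} [TopologicalSpace M] [ChartedSpace H M]

section

variable [I.Boundaryless]

theorem differential_eq_fderiv {φ : M → ℝ} {p : M} (hφ : MDifferentiableAt I 𝓘(ℝ, ℝ) φ p) :
    differential I φ p = (fderiv ℝ (φ ∘ (extChartAt I p).symm) (extChartAt I p p) : E →L[ℝ] ℝ) := by
  rw [differential, hφ.mfderiv, I.range_eq_univ, fderivWithin_univ]
  rfl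

theorem contDiffAt_comp_extChartAt_symm {V : Type*} [NormedAddCommGroup V] [NormedSpace ℝ V]
    {φ : M → V} {p : M} {n : WithTop ℕ∞} (hφ : ContMDiffAt I 𝓘(ℝ, V) n φ p) :
    ContDiffAt ℝ n (φ ∘ (extChartAt I p).symm) (extChartAt I p p) := by
  have := (contMDiffAt_iff.1 hφ).2
  rw [I.range_eq_univ, contDiffWithinAt_univ] at this
  exact this

end

variable [IsManifold I ∞ M]

theorem ricci_eq_coordRicci [FiniteDimensional ℝ E] (g : SmoothMetric I M) (p : M) :
    ricci g p = (coordRicci (chartMetric g p) (extChartAt I p p) : E →L[ℝ] E →L[ℝ] ℝ) := by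
  rw [ricci, mfderiv_extChartAt_self]
  rfl

theorem hessian_eq_coordHessian (g : SmoothMetric I M) (φ : M → ℝ) (p : M) :
    hessian g φ p = (coordHessian (chartMetric g p) (φ ∘ (extChartAt I p).symm)
      (extChartAt I p p) : E →L[ℝ] E →L[ℝ] ℝ) := by
  rw [hessian, mfderiv_extChartAt_self]
  rfl

variable [I.Boundaryless]

theorem mfderiv_extChartAt_symm_eq_symmL (p : M) {u : E} (hu : u ∈ (extChartAt I p).target) :
    mfderiv 𝓘(ℝ, E) I (extChartAt I p).symm u
      = (trivializationAt E (fun x : M ↦ TangentSpace I x) p).symmL ℝ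
          ((extChartAt I p).symm u) := by
  have hs : (extChartAt I p).symm u ∈ (chartAt H p).source := by
    rw [← extChartAt_source I]
    exact (extChartAt I p).map_target hu
  have := TangentBundle.symmL_trivializationAt (I := I) (x₀ := p) hs
  rw [I.range_eq_univ, mfderivWithin_univ, (extChartAt I p).right_inv hu] at this
  exact this.symm

theorem chartMetric_self (g : SmoothMetric I M) (p : M) :
    chartMetric g p (extChartAt I p p) = (g.inner p : E →L[ℝ] E →L[ℝ] ℝ) := by
  have h := mfderivWithin_range_extChartAt_symm (I := I) (x := p)
  rw [I.range_eq_univ, mfderivWithin_univ] at h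
  let b : M → E →L[ℝ] E →L[ℝ] ℝ := g.inner
  let A : E →L[ℝ] E := mfderiv 𝓘(ℝ, E) I (extChartAt I p).symm (extChartAt I p p)
  have hA : A = ContinuousLinearMap.id ℝ E := h
  have hb : pullbackForm (b ((extChartAt I p).symm (extChartAt I p p))) A = b p := by
    rw [hA, (extChartAt I p).left_inv (mem_extChartAt_source p)]
    rfl
  exact hb

theorem gradient_eq_coordGradient (g : SmoothMetric I M) {φ : M → ℝ} {p : M}
    (hφ : MDifferentiableAt I 𝓘(ℝ, ℝ) φ p) :
    gradient g φ p = (coordGradient (chartMetric g p) (φ ∘ (extChartAt I p).symm)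
      (extChartAt I p p) : E) := by
  rw [gradient, differential_eq_fderiv hφ, coordGradient, chartMetric_self]
  rfl

theorem laplacian_eq_metricTrace (g : SmoothMetric I M) (φ : M → ℝ) (p : M) :
    laplacian g φ p = metricTrace (chartMetric g p (extChartAt I p p))
      (coordHessian (chartMetric g p) (φ ∘ (extChartAt I p).symm) (extChartAt I p p)) := by
  rw [laplacian, hessian_eq_coordHessian, chartMetric_self]
  rfl

variable [FiniteDimensional ℝ E]

theorem isMetricAt_chartMetric (g : SmoothMetric I M) (p : M) :
    IsMetricAt (chartMetric g p) (extChartAt I p p) where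
  contDiffAt := by
    have h := ((contMDiffAt_hom_bundle _).1 (g.contMDiff p)).2
    refine ((contDiffAt_comp_extChartAt_symm h).of_le (by norm_cast)).congr_of_eventuallyEq
      ?_
    filter_upwards [extChartAt_target_mem_nhds (I := I) p] with u hu
    have hs : (extChartAt I p).symm u ∈ (chartAt H p).source := by
      rw [← extChartAt_source I]
      exact (extChartAt I p).map_target hu
    refine Eq.trans ?_ (inCoordinates_form g.inner hs).symm
    rw [← mfderiv_extChartAt_symm_eq_symmL p hu]
    rfl
  symm := Filter.Eventually.of_forall fun u v w ↦ g.symm _ _ _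
  isInvertible := by
    filter_upwards [extChartAt_target_mem_nhds (I := I) p] with u hu
    have hi := isInvertible_mfderivWithin_extChartAt_symm (I := I) (x := p) hu
    rw [I.range_eq_univ, mfderivWithin_univ] at hi
    refine isInvertible_of_injective fun v hv ↦ ?_
    by_contra h0
    have h1 : mfderiv 𝓘(ℝ, E) I (extChartAt I p).symm u v ≠ 0 :=
      fun h ↦ h0 (hi.injective (h.trans (map_zero _).symm))
    exact (g.pos _ _ h1).ne' (congrArg (fun L : E →L[ℝ] ℝ ↦ L v) hv)

theorem inner_gradient (g : SmoothMetric I M) (φ : M → ℝ) (p : M) (v : TangentSpace I p) :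
    g.inner p (gradient g φ p) v = differential I φ p v := by
  have h := (isMetricAt_chartMetric g p).invertible
  rw [chartMetric_self] at h
  exact congrArg (fun L : E →L[ℝ] ℝ ↦ L v) (h.self_apply_inverse (differential I φ p))

end Charts

section WarpedProduct

variable {E : Type*} [NormedAddCommGroup E] [NormedSpace ℝ E]
  {H : Type*} [TopologicalSpace H] {I : ModelWithCorners ℝ E H} [I.Boundaryless]
  {B : Type*} [TopologicalSpace B] [ChartedSpace H B] [IsManifold I ∞ B]
  {E' : Type*} [NormedAddCommGroup E'] [NormedSpace ℝ E']
  {H' : Type*} [TopologicalSpace H'] {J : ModelWithCorners ℝ E' H'} [J.Boundaryless]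
  {F : Type*} [TopologicalSpace F] [ChartedSpace H' F] [IsManifold J ∞ F]
  (gB : SmoothMetric I B) (gF : SmoothMetric J F) {f : B → ℝ}
  (hf : ContMDiff I 𝓘(ℝ, ℝ) ∞ f) (hpos : ∀ x, 0 < f x)

theorem chartMetric_warpedMetric (p : B × F) :
    chartMetric (warpedMetric gB gF f hf hpos) p =ᶠ[nhds (extChartAt (I.prod J) p p)]
      coordWarped (chartMetric gB p.1) (chartMetric gF p.2) (f ∘ (extChartAt I p.1).symm) := by
  filter_upwards [extChartAt_target_mem_nhds (I := I.prod J) p] with u hu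
  have hu1 : u.1 ∈ (extChartAt I p.1).target ∧ u.2 ∈ (extChartAt J p.2).target := by
    rw [extChartAt_prod, PartialEquiv.prod_target] at hu
    exact hu
  have hs1 : (extChartAt I p.1).symm u.1 ∈ (chartAt H p.1).source := by
    rw [← extChartAt_source I]
    exact (extChartAt I p.1).map_target hu1.1
  have hs2 : (extChartAt J p.2).symm u.2 ∈ (chartAt H' p.2).source := by
    rw [← extChartAt_source J]
    exact (extChartAt J p.2).map_target hu1.2
  have hq : (extChartAt (I.prod J) p).symm u
      = ((extChartAt I p.1).symm u.1, (extChartAt J p.2).symm u.2) := by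
    rw [extChartAt_prod]
    rfl
  refine ContinuousLinearMap.ext fun v ↦ ContinuousLinearMap.ext fun w ↦ ?_
  unfold chartMetric
  rw [mfderiv_extChartAt_symm_eq_symmL p hu, hq,
    symmL_prod (p := ((extChartAt I p.1).symm u.1, (extChartAt J p.2).symm u.2)) hs1 hs2]
  refine (warpedForm_apply gB gF f _ _ _).trans ?_
  rw [mfderiv_fst, mfderiv_snd]
  unfold coordWarped
  rw [sumForm_apply]
  dsimp only
  rw [mfderiv_extChartAt_symm_eq_symmL p.1 hu1.1, mfderiv_extChartAt_symm_eq_symmL p.2 hu1.2]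
  rfl

end WarpedProduct

section Trace

variable {E : Type*} [NormedAddCommGroup E] [NormedSpace ℝ E] [FiniteDimensional ℝ E]
  {H : Type*} [TopologicalSpace H] {I : ModelWithCorners ℝ E H} [I.Boundaryless]
  {M : Type*} [TopologicalSpace M] [ChartedSpace H M] [IsManifold I ∞ M]

theorem isInvertible_inner (g : SmoothMetric I M) (p : M) :
    (g.inner p : E →L[ℝ] E →L[ℝ] ℝ).IsInvertible := by
  rw [← chartMetric_self]
  exact (isMetricAt_chartMetric g p).invertible

theorem mul_scalarCurvature_of_ricci (g : SmoothMetric I M) (p : M) {a c : ℝ}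
    (h : ∀ v w : TangentSpace I p, a * ricci g p v w = c * g.inner p v w) :
    a * scalarCurvature g p = c * Module.finrank ℝ E :=
  mul_metricTrace_of_smul_eq (V := E) (isInvertible_inner g p) h

end Trace

section WarpedProduct

variable {E : Type*} [NormedAddCommGroup E] [NormedSpace ℝ E] [FiniteDimensional ℝ E]
  {H : Type*} [TopologicalSpace H] {I : ModelWithCorners ℝ E H} [I.Boundaryless]
  {B : Type*} [TopologicalSpace B] [ChartedSpace H B] [IsManifold I ∞ B]
  {E' : Type*} [NormedAddCommGroup E'] [NormedSpace ℝ E'] [FiniteDimensional ℝ E']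
  {H' : Type*} [TopologicalSpace H'] {J : ModelWithCorners ℝ E' H'} [J.Boundaryless]
  {F : Type*} [TopologicalSpace F] [ChartedSpace H' F] [IsManifold J ∞ F]
  (gB : SmoothMetric I B) (gF : SmoothMetric J F) {f h : B → ℝ}
  (hf : ContMDiff I 𝓘(ℝ, ℝ) ∞ f) (hpos : ∀ x, 0 < f x)

omit [FiniteDimensional ℝ E] [I.Boundaryless] [FiniteDimensional ℝ E'] [J.Boundaryless] in
theorem warpedMetric_inner (p : B × F) :
    (warpedMetric gB gF f hf hpos).inner p = (sumForm (gB.inner p.1 : E →L[ℝ] E →L[ℝ] ℝ)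
      (gF.inner p.2 : E' →L[ℝ] E' →L[ℝ] ℝ) (f p.1 ^ 2) : E × E' →L[ℝ] E × E' →L[ℝ] ℝ) := by
  refine ContinuousLinearMap.ext fun v ↦ ContinuousLinearMap.ext fun w ↦ ?_
  refine (warpedForm_apply gB gF f p v w).trans ?_
  rw [mfderiv_fst, mfderiv_snd]
  rfl

theorem ricci_warpedMetric (p : B × F) :
    ricci (warpedMetric gB gF f hf hpos) p
      = (sumForm ((ricci gB p.1 : E →L[ℝ] E →L[ℝ] ℝ)
            - (Module.finrank ℝ E' / f p.1) • (hessian gB f p.1 : E →L[ℝ] E →L[ℝ] ℝ))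
          ((ricci gF p.2 : E' →L[ℝ] E' →L[ℝ] ℝ) - (f p.1 * laplacian gB f p.1
            + (Module.finrank ℝ E' - 1) * gB.inner p.1 (gradient gB f p.1) (gradient gB f p.1))
              • (gF.inner p.2 : E' →L[ℝ] E' →L[ℝ] ℝ)) 1 : E × E' →L[ℝ] E × E' →L[ℝ] ℝ) := by
  have hd : MDifferentiableAt I 𝓘(ℝ, ℝ) f p.1 := (hf p.1).mdifferentiableAt (by simp)
  have hφ := (contDiffAt_comp_extChartAt_symm (hf p.1)).of_le (m := 2) (by norm_cast)
  have hp : (f ∘ (extChartAt I p.1).symm) (extChartAt I p.1 p.1) = f p.1 := by simp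
  rw [ricci_eq_coordRicci, coordRicci_congr (chartMetric_warpedMetric gB gF hf hpos p),
    ricci_eq_coordRicci, ricci_eq_coordRicci, hessian_eq_coordHessian, laplacian_eq_metricTrace,
    inner_gradient, gradient_eq_coordGradient gB hd, differential_eq_fderiv hd,
    ← chartMetric_self gF p.2]
  have := coordRicci_coordWarped (u := (extChartAt I p.1 p.1, extChartAt J p.2 p.2))
    (isMetricAt_chartMetric gB p.1) (isMetricAt_chartMetric gF p.2) hφ
    (by rw [hp]; exact (hpos p.1).ne')
  dsimp only at this
  rw [hp] at this
  rw [extChartAt_prod]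
  exact this

theorem hessian_warpedMetric (hh : ContMDiff I 𝓘(ℝ, ℝ) ∞ h) (p : B × F) :
    hessian (warpedMetric gB gF f hf hpos) (h ∘ Prod.fst) p
      = (sumForm (hessian gB h p.1 : E →L[ℝ] E →L[ℝ] ℝ)
          ((f p.1 * differential I f p.1 (gradient gB h p.1))
            • (gF.inner p.2 : E' →L[ℝ] E' →L[ℝ] ℝ)) 1 : E × E' →L[ℝ] E × E' →L[ℝ] ℝ) := by
  have hd : MDifferentiableAt I 𝓘(ℝ, ℝ) f p.1 := (hf p.1).mdifferentiableAt (by simp)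
  have hd' : MDifferentiableAt I 𝓘(ℝ, ℝ) h p.1 := (hh p.1).mdifferentiableAt (by simp)
  have hφ := (contDiffAt_comp_extChartAt_symm (hf p.1)).of_le (m := 2) (by norm_cast)
  have hψ := (contDiffAt_comp_extChartAt_symm (hh p.1)).of_le (m := 2) (by norm_cast)
  have hp : (f ∘ (extChartAt I p.1).symm) (extChartAt I p.1 p.1) = f p.1 := by simp
  rw [hessian_eq_coordHessian, coordHessian_congr (chartMetric_warpedMetric gB gF hf hpos p),
    hessian_eq_coordHessian, gradient_eq_coordGradient gB hd', differential_eq_fderiv hd,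
    ← chartMetric_self gF p.2]
  have := coordHessian_coordWarped (u := (extChartAt I p.1 p.1, extChartAt J p.2 p.2))
    (isMetricAt_chartMetric gB p.1) (isMetricAt_chartMetric gF p.2) hφ
    (by rw [hp]; exact (hpos p.1).ne') hψ
  dsimp only at this
  rw [hp] at this
  rw [extChartAt_prod]
  exact this

theorem scalarCurvature_warpedMetric (p : B × F) :
    scalarCurvature (warpedMetric gB gF f hf hpos) p
      = scalarCurvature gB p.1 - Module.finrank ℝ E' / f p.1 * laplacian gB f p.1
        + (f p.1 ^ 2)⁻¹ * (scalarCurvature gF p.2 - Module.finrank ℝ E' *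
          (f p.1 * laplacian gB f p.1 + (Module.finrank ℝ E' - 1)
            * gB.inner p.1 (gradient gB f p.1) (gradient gB f p.1))) := by
  rw [scalarCurvature, ricci_warpedMetric, warpedMetric_inner,
    mul_comm (Module.finrank ℝ E' : ℝ) (_ + _)]
  exact metricTrace_sumForm_sub (V := E) (W := E') (isInvertible_inner gB p.1)
    (isInvertible_inner gF p.2) (pow_ne_zero 2 (hpos p.1).ne') _ _

omit [FiniteDimensional ℝ E] [I.Boundaryless] [IsManifold I ∞ B] [FiniteDimensional ℝ E']
  [J.Boundaryless] [IsManifold J ∞ F] in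
theorem differential_comp_fst {p : B × F} (hh : MDifferentiableAt I 𝓘(ℝ, ℝ) h p.1) (v : E × E') :
    (differential (I.prod J) (h ∘ Prod.fst) p : E × E' →L[ℝ] ℝ) v
      = (differential I h p.1 : E →L[ℝ] ℝ) v.1 := by
  have := mfderiv_comp p hh (mdifferentiableAt_fst (I := I) (I' := J))
  rw [mfderiv_fst] at this
  exact congrArg (fun L : E × E' →L[ℝ] ℝ ↦ L v) this

/-- The right-hand side of the scalar identity on the fiber. -/
def fiberFunction (gB : SmoothMetric I B) (f : B → ℝ) (m α β ρ : ℝ) (h lam : B → ℝ) (x : B) : ℝ :=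
  ρ * scalarCurvature gB x * f x ^ 2 + lam x * f x ^ 2
    + (α - 2 * m * ρ) * f x * laplacian gB f x
    - β * f x * differential I f x (gradient gB h x)
    + (m - 1) * (α - m * ρ) * gB.inner x (gradient gB f x) (gradient gB f x)

theorem einsteinTypeEquation_warpedMetric_iff (hh : ContMDiff I 𝓘(ℝ, ℝ) ∞ h) (lam : B → ℝ)
    (α β μ ρ : ℝ) :
    EinsteinTypeEquation (warpedMetric gB gF f hf hpos) α β μ ρ (h ∘ Prod.fst) (lam ∘ Prod.fst) ↔
      (∀ (x : B) (y : F) (v w : TangentSpace I x),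
        α * ricci gB x v w + β * hessian gB h x v w
            + μ * (differential I h x v * differential I h x w)
          = α * Module.finrank ℝ E' / f x * hessian gB f x v w
            + (ρ * scalarCurvature (warpedMetric gB gF f hf hpos) (x, y) + lam x)
              * gB.inner x v w) ∧
      ∀ (x : B) (y : F) (v w : TangentSpace J y),
        α * ricci gF y v w = (ρ * scalarCurvature gF y
          + fiberFunction gB f (Module.finrank ℝ E') α β ρ h lam x) * gF.inner y v w := by
  have hpt (x : B) (y : F) : (∀ v w : E × E',
      α * ricci (warpedMetric gB gF f hf hpos) (x, y) v w
          + β * hessian (warpedMetric gB gF f hf hpos) (h ∘ Prod.fst) (x, y) v w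
          + μ * (differential (I.prod J) (h ∘ Prod.fst) (x, y) v
            * differential (I.prod J) (h ∘ Prod.fst) (x, y) w)
        = (ρ * scalarCurvature (warpedMetric gB gF f hf hpos) (x, y) + lam x)
          * (warpedMetric gB gF f hf hpos).inner (x, y) v w) ↔
      (∀ v w : E, α * ricci gB x v w + β * hessian gB h x v w
            + μ * (differential I h x v * differential I h x w)
          = α * Module.finrank ℝ E' / f x * hessian gB f x v w
            + (ρ * scalarCurvature (warpedMetric gB gF f hf hpos) (x, y) + lam x)
              * gB.inner x v w) ∧
      ∀ v w : E', α * ricci gF y v w = (ρ * scalarCurvature gF y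
          + fiberFunction gB f (Module.finrank ℝ E') α β ρ h lam x) * gF.inner y v w := by
    have hc : ρ * scalarCurvature gF y + fiberFunction gB f (Module.finrank ℝ E') α β ρ h lam x
        = α * (f x * laplacian gB f x + (Module.finrank ℝ E' - 1)
            * gB.inner x (gradient gB f x) (gradient gB f x))
          - β * (f x * differential I f x (gradient gB h x))
          + (ρ * scalarCurvature (warpedMetric gB gF f hf hpos) (x, y) + lam x) * f x ^ 2 := by
      have := (hpos x).ne'
      rw [scalarCurvature_warpedMetric, fiberFunction]
      field_simp
      ring
    rw [hc, ricci_warpedMetric, hessian_warpedMetric gB gF hf hpos hh, warpedMetric_inner]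
    refine Iff.trans (forall₂_congr fun v w ↦ ?_) (sumForm_equation_iff (V := E) (W := E')
      α β μ _ _ _ _ _ (ricci gB x) (hessian gB h x) (hessian gB f x) (gB.inner x) (ricci gF y) (gF.inner y)
      (differential I h x))
    have hd := (hh x).mdifferentiableAt (by simp)
    exact Eq.congr_left (congrArg (_ + μ * ·) (congrArg₂ (· * ·)
      (differential_comp_fst (J := J) (p := (x, y)) hd v)
      (differential_comp_fst (J := J) (p := (x, y)) hd w)))
  exact ⟨fun H ↦ ⟨fun x y ↦ ((hpt x y).1 (H (x, y))).1, fun x y ↦ ((hpt x y).1 (H (x, y))).2⟩,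
    fun H p ↦ (hpt p.1 p.2).2 ⟨H.1 p.1 p.2, H.2 p.1 p.2⟩⟩

end WarpedProduct

theorem fiberConditions_iff {n m : ℕ} (hn : 0 < n) (hm : 0 < m)
    {B : Type*} [TopologicalSpace B] [ChartedSpace (EuclideanSpace ℝ (Fin n)) B]
    [IsManifold (𝓡 n) ∞ B] [Nonempty B]
    {F : Type*} [TopologicalSpace F] [ChartedSpace (EuclideanSpace ℝ (Fin m)) F]
    [IsManifold (𝓡 m) ∞ F] [Nonempty F]
    (gB : SmoothMetric (𝓡 n) B) (gF : SmoothMetric (𝓡 m) F)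
    {f h lam : B → ℝ} (hf : ContMDiff (𝓡 n) 𝓘(ℝ, ℝ) ∞ f) (hpos : ∀ x, 0 < f x) {α β μ ρ : ℝ}
    (hbase : BaseCondition gB (warpedMetric gB gF f hf hpos) f α β μ ρ h lam) :
    (∀ (x : B) (y : F) (v w : TangentSpace (𝓡 m) y), α * ricci gF y v w
      = (ρ * scalarCurvature gF y + fiberFunction gB f m α β ρ h lam x) * gF.inner y v w) ↔
    FiberCondition gB gF f α β ρ h lam ∧ (α ≠ 0 → IsEinstein gF) := by
  have hm' : (m : ℝ) ≠ 0 := by exact_mod_cast hm.ne'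
  obtain ⟨x₀⟩ := ‹Nonempty B›
  obtain ⟨y₀⟩ := ‹Nonempty F›
  have := Fin.pos_iff_nonempty.1 hn
  have := Fin.pos_iff_nonempty.1 hm
  constructor
  · intro H
    have htr (x : B) (y : F) : (α / m - ρ) * scalarCurvature gF y
        = fiberFunction gB f m α β ρ h lam x := by
      have := mul_scalarCurvature_of_ricci gF y (H x y)
      rw [finrank_euclideanSpace_fin] at this
      field_simp
      linear_combination this
    have hconst : (α, ρ) ≠ (0, 0) → ∀ y, scalarCurvature gF y = scalarCurvature gF y₀ := by
      intro h0 y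
      by_cases hρ : ρ = 0
      · have hα : α ≠ 0 := fun hα ↦ h0 (by rw [hα, hρ])
        have h1 := (htr x₀ y).trans (htr x₀ y₀).symm
        rw [hρ, sub_zero] at h1
        exact mul_left_cancel₀ (div_ne_zero hα hm') h1
      · obtain ⟨v, hv⟩ := exists_ne (0 : EuclideanSpace ℝ (Fin n))
        have h1 := (hbase x₀ y v v).symm.trans (hbase x₀ y₀ v v)
        have h2 := mul_right_cancel₀ (gB.pos x₀ v hv).ne' (add_left_cancel h1)
        have h3 := mul_left_cancel₀ hρ (add_right_cancel h2)
        rw [scalarCurvature_warpedMetric, scalarCurvature_warpedMetric] at h3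
        have h4 := mul_left_cancel₀ (inv_ne_zero (pow_ne_zero 2 (hpos x₀).ne'))
          (add_left_cancel h3)
        exact sub_left_injective h4
    refine ⟨⟨fun h0 ↦ ⟨_, hconst h0⟩, fun x y ↦ htr x y⟩, fun hα ↦
      ⟨scalarCurvature gF y₀ / m, fun y v w ↦ mul_left_cancel₀ hα ?_⟩⟩
    rw [H x₀ y v w, ← htr x₀ y, hconst (fun h ↦ hα (congrArg Prod.fst h)) y]
    ring
  · rintro ⟨hfib, hE⟩ x y v w
    have htr : (α / m - ρ) * scalarCurvature gF y = fiberFunction gB f m α β ρ h lam x :=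
      hfib.2 x y
    rw [← htr]
    by_cases hα : α = 0
    · simp [hα]
    · obtain ⟨θ, hθ⟩ := hE hα
      have h1 := mul_scalarCurvature_of_ricci gF y (a := 1) (c := θ) fun v w ↦ by
        rw [one_mul, hθ]
      rw [finrank_euclideanSpace_fin, one_mul] at h1
      rw [hθ, h1]
      field_simp
      ring

end WarpedEinstein

end

theorem theorem1 {n m : ℕ} (hn : 0 < n) (hm : 0 < m)
    {B : Type*} [TopologicalSpace B] [ChartedSpace (EuclideanSpace ℝ (Fin n)) B]
    [IsManifold (𝓡 n) ∞ B] [Nonempty B]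
    {F : Type*} [TopologicalSpace F] [ChartedSpace (EuclideanSpace ℝ (Fin m)) F]
    [IsManifold (𝓡 m) ∞ F] [Nonempty F]
    (gB : WarpedEinstein.SmoothMetric (𝓡 n) B) (gF : WarpedEinstein.SmoothMetric (𝓡 m) F)
    (f h lam : B → ℝ) (hf : ContMDiff (𝓡 n) 𝓘(ℝ, ℝ) ∞ f) (hpos : ∀ x, 0 < f x)
    (hh : ContMDiff (𝓡 n) 𝓘(ℝ, ℝ) ∞ h) (hlam : ContMDiff (𝓡 n) 𝓘(ℝ, ℝ) ∞ lam)
    (α β μ ρ : ℝ) (hβ : β ≠ 0) :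
    (WarpedEinstein.EinsteinTypeEquation (WarpedEinstein.warpedMetric gB gF f hf hpos) α β μ ρ
        (h ∘ Prod.fst) (lam ∘ Prod.fst) ↔
      WarpedEinstein.BaseCondition gB (WarpedEinstein.warpedMetric gB gF f hf hpos)
          f α β μ ρ h lam ∧
        WarpedEinstein.FiberCondition gB gF f α β ρ h lam ∧
        (α ≠ 0 → WarpedEinstein.IsEinstein gF)) ∧
    (WarpedEinstein.IsGradientEinsteinType (WarpedEinstein.warpedMetric gB gF f hf hpos) α β μ ρ
        (h ∘ Prod.fst) (lam ∘ Prod.fst) ↔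
      WarpedEinstein.IsGeodesicallyComplete (WarpedEinstein.warpedMetric gB gF f hf hpos) ∧
        WarpedEinstein.BaseCondition gB (WarpedEinstein.warpedMetric gB gF f hf hpos)
          f α β μ ρ h lam ∧
        WarpedEinstein.FiberCondition gB gF f α β ρ h lam ∧
        (α ≠ 0 → WarpedEinstein.IsEinstein gF)) := by

  have key : WarpedEinstein.EinsteinTypeEquation (WarpedEinstein.warpedMetric gB gF f hf hpos)
        α β μ ρ (h ∘ Prod.fst) (lam ∘ Prod.fst) ↔
      WarpedEinstein.BaseCondition gB (WarpedEinstein.warpedMetric gB gF f hf hpos)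
          f α β μ ρ h lam ∧
        WarpedEinstein.FiberCondition gB gF f α β ρ h lam ∧
        (α ≠ 0 → WarpedEinstein.IsEinstein gF) := by
    rw [WarpedEinstein.einsteinTypeEquation_warpedMetric_iff gB gF hf hpos hh lam,
      finrank_euclideanSpace_fin]
    exact and_congr_right fun hbase ↦
      WarpedEinstein.fiberConditions_iff hn hm gB gF hf hpos hbase
  refine ⟨key, fun H ↦ ⟨H.complete, key.1 H.equation⟩, fun H ↦ ⟨H.1, ?_, ?_, ?_, key.2 H.2⟩⟩
  · exact fun h0 ↦ hβ (congrArg (fun t : ℝ × ℝ × ℝ ↦ t.2.1) h0)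
  · exact hh.comp contMDiff_fst
  · exact hlam.comp contMDiff_fst
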